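/- Let $G$ be a finite-dimensional real Lie group with Lie algebra $\mathcal G$, and let $U$ be a strongly continuous unitary representation of $G$ on a separable complex Hilbert space $\mathcal H$. Let $\mathcal D^\infty(U)$ be the space of $C^\infty$-vectors, i.e. of those $\phi\in\mathcal H$ for which $g\mapsto U(g)\phi$ is a $C^\infty$ map from $G$ to $\mathcal H$. For $x\in\mathcal G$ and $\phi\in\mathcal D^\infty(U)$ put $dU(x)\phi=\frac{d}{dt}U(\exp tx)\phi|_{t=0}$; extend $dU$ to a representation of the enveloping algebra $\mathcal E(\mathcal G)$ (the universal enveloping algebra of $\mathcal G_{\mathbb C}$) on $\mathcal D^\infty(U)$, and let $\mathcal M=dU(\mathcal E(\mathcal G))$. Let $\mathcal T_1(\mathcal M)$ be the set of trace class operators $\hat T$ on $\mathcal H$ with $\hat T\mathcal H\subset\mathcal D^\infty(U)$, $\hat T^*\mathcal H\subset\mathcal D^\infty(U)$ and $\hat A\hat T,\hat A\hat T^*$ trace class for all $\hat A\in\mathcal M$. The state space $\mathcal E_S(\mathcal M)$ is the set of positive self-adjoint $\hat\rho\in\mathcal T_1(\mathcal M)$ with $\mathrm{Tr}\,\hat\rho=1$,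 with the weakest topology that makes all functions $\hat\rho\mapsto \mathrm{Tr}\,\hat A\hat\rho$, $\hat A\in\mathcal M$, continuous. For an essentially self-adjoint operator $\hat A\in\mathcal M$ and an open set $W\subset\mathcal E_S(\mathcal M)$ the qr-number $a_Q(W)$ is the continuous real-valued function $\hat\rho\mapsto\mathrm{Tr}\,\hat A\hat\rho$ on $W$. Then for every non-empty open set $W\subset\mathcal E_S(\mathcal M)$ and all essentially self-adjoint $\hat A,\hat B\in\mathcal M$, with qr-numbers $a_Q(W)$ and $b_Q(W)$: $a_Q(W)=b_Q(W)$ if and only if $\hat A=\hat B$. Consequently, for each such $W$, the map $\hat A\mapsto a_Q(W)$ is injective on the essentially self-adjoint operators in $\mathcal M$, so that $a_Q(W)$ determines $\hat A$. -/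

import Mathlib

open scoped Manifold ContDiff

set_option linter.unusedSectionVars false

noncomputable section

namespace QRNumbers

open Bundle VectorField

attribute [local instance] LieRing.ofAssociativeRing

section LieGroup
variable {E : Type*} [NormedAddCommGroup E] [NormedSpace ℝ E]
  {G : Type*} [TopologicalSpace G] [ChartedSpace E G] [Group G] [LieGroup 𝓘(ℝ, E) ∞ G]
  {F : Type*} [NormedAddCommGroup F] [NormedSpace ℝ F]

/-- A smooth Lie group has the regularity under which its tangent space at the identity is a Lie
algebra. -/
instance instLieGroupMinSmoothness : LieGroup 𝓘(ℝ, E) (minSmoothness ℝ 3) G :=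
  LieGroup.of_le (n := ∞) (by simpa using ENat.LEInfty.out)

/-- Left-invariant vector fields on a smooth Lie group are smooth. -/
theorem contMDiff_infty_mulInvariantVectorField (v : GroupLieAlgebra 𝓘(ℝ, E) G) :
    ContMDiff 𝓘(ℝ, E) 𝓘(ℝ, E).tangent ∞
      (fun g : G => (⟨g, mulInvariantVectorField v g⟩ : TangentBundle 𝓘(ℝ, E) G)) := by
  let fg : G → TangentBundle 𝓘(ℝ, E) G := fun g ↦ TotalSpace.mk' E g 0
  have sfg : CMDiff ∞ fg := contMDiff_zeroSection _ _
  let fv : G → TangentBundle 𝓘(ℝ, E) G := fun _ ↦ TotalSpace.mk' E 1 v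
  have sfv : CMDiff ∞ fv := contMDiff_const
  let F₁ : G → (TangentBundle 𝓘(ℝ, E) G × TangentBundle 𝓘(ℝ, E) G) := fun g ↦ (fg g, fv g)
  have S₁ : CMDiff ∞ F₁ := sfg.prodMk sfv
  let F₂ : (TangentBundle 𝓘(ℝ, E) G × TangentBundle 𝓘(ℝ, E) G) →
      TangentBundle (𝓘(ℝ, E).prod 𝓘(ℝ, E)) (G × G) :=
    (equivTangentBundleProd 𝓘(ℝ, E) G 𝓘(ℝ, E) G).symm
  have S₂ : CMDiff ∞ F₂ := contMDiff_equivTangentBundleProd_symm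
  let F₃ : TangentBundle (𝓘(ℝ, E).prod 𝓘(ℝ, E)) (G × G) → TangentBundle 𝓘(ℝ, E) G :=
    tangentMap% (fun (p : G × G) ↦ p.1 * p.2)
  have S₃ : CMDiff ∞ F₃ := by
    apply ContMDiff.contMDiff_tangentMap (n := ∞) _ (m := ∞) (by simp)
    exact contMDiff_mul 𝓘(ℝ, E) ∞
  let S := (S₃.comp S₂).comp S₁
  convert! S with g
  · simp [F₁, F₂, F₃, fg, fv]
  · simp only [Function.comp_apply, tangentMap, F₃, F₂, F₁, fg, fv]
    rw [mfderiv_prod_eq_add_apply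
      ((contMDiff_mul 𝓘(ℝ, E) ∞).mdifferentiableAt (by simp))]
    change (mfderiv 𝓘(ℝ, E) 𝓘(ℝ, E) (fun x => g * x) 1) v =
      (mfderiv 𝓘(ℝ, E) 𝓘(ℝ, E) (fun x => x * (1 : G)) g) 0 +
      (mfderiv 𝓘(ℝ, E) 𝓘(ℝ, E) (fun x => g * x) 1) v
    rw [map_zero, zero_add]

/-- The derivative of `f : G → F` along a vector field `V`. -/
def derivAlong (f : G → F) (V : (g : G) → TangentSpace 𝓘(ℝ, E) g) (g : G) : F :=
  mfderiv 𝓘(ℝ, E) 𝓘(ℝ, F) f g (V g)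

/-- The derivative of a smooth function along a left-invariant vector field is smooth. -/
theorem contMDiff_derivAlong_mulInvariantVectorField {f : G → F}
    (hf : ContMDiff 𝓘(ℝ, E) 𝓘(ℝ, F) ∞ f) (v : GroupLieAlgebra 𝓘(ℝ, E) G) :
    ContMDiff 𝓘(ℝ, E) 𝓘(ℝ, F) ∞ (derivAlong f (mulInvariantVectorField v)) := by
  have h1 := hf.contMDiff_tangentMap (m := ∞) (by simp)
  have h2 := (contMDiff_snd_tangentBundle_modelSpace (n := ∞) F 𝓘(ℝ, F)).comp
    (h1.comp (contMDiff_infty_mulInvariantVectorField v))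
  exact h2

/-- Differentiation along `[V, W]` is the commutator of the differentiations along `V` and `W`. -/
theorem derivAlong_mlieBracket [CompleteSpace E] {f : G → F}
    (hf : ContMDiff 𝓘(ℝ, E) 𝓘(ℝ, F) ∞ f) {V W : (g : G) → TangentSpace 𝓘(ℝ, E) g} (x : G)
    (hV : MDifferentiableAt 𝓘(ℝ, E) 𝓘(ℝ, E).tangent
      (fun g => (⟨g, V g⟩ : TangentBundle 𝓘(ℝ, E) G)) x)
    (hW : MDifferentiableAt 𝓘(ℝ, E) 𝓘(ℝ, E).tangent
      (fun g => (⟨g, W g⟩ : TangentBundle 𝓘(ℝ, E) G)) x)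
    (hfV : MDifferentiableAt 𝓘(ℝ, E) 𝓘(ℝ, F) (derivAlong f V) x)
    (hfW : MDifferentiableAt 𝓘(ℝ, E) 𝓘(ℝ, F) (derivAlong f W) x) :
    derivAlong f (mlieBracket 𝓘(ℝ, E) V W) x =
      derivAlong (derivAlong f W) V x - derivAlong (derivAlong f V) W x := by
  have : IsManifold 𝓘(ℝ, E) 2 G := IsManifold.of_le (n := ∞) ENat.LEInfty.out
  have : IsManifold 𝓘(ℝ, E) 1 G := IsManifold.of_le (n := ∞) ENat.LEInfty.out
  set φ := extChartAt 𝓘(ℝ, E) x with hφ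
  set y := φ x with hy
  have hyt : y ∈ φ.target := mem_extChartAt_target x
  have hopen : IsOpen φ.target := isOpen_extChartAt_target x
  have hnt : φ.target ∈ nhds y := hopen.mem_nhds hyt
  have hyx : φ.symm y = x := extChartAt_to_inv x
  let V' : E → E := fun z => (mfderiv 𝓘(ℝ, E) 𝓘(ℝ, E) φ.symm z).inverse (V (φ.symm z))
  let W' : E → E := fun z => (mfderiv 𝓘(ℝ, E) 𝓘(ℝ, E) φ.symm z).inverse (W (φ.symm z))
  let B : E := lieBracket ℝ V' W' y
  have hbr : mlieBracket 𝓘(ℝ, E) V W x = (mfderiv 𝓘(ℝ, E) 𝓘(ℝ, E) φ x).inverse B := by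
    rw [← mlieBracketWithin_univ, mlieBracketWithin_apply]
    simp only [modelWithCornersSelf_coe, Set.range_id, Set.preimage_univ, Set.inter_univ,
      mpullbackWithin_univ]
    have e : lieBracketWithin ℝ V' W' Set.univ y = B := by rw [lieBracketWithin_univ]
    exact congrArg (mfderiv 𝓘(ℝ, E) 𝓘(ℝ, E) φ x).inverse e
  have hinv : ∀ z ∈ φ.target, (mfderiv 𝓘(ℝ, E) 𝓘(ℝ, E) φ.symm z).IsInvertible := by
    intro z hz
    have h := isInvertible_mfderivWithin_extChartAt_symm (I := 𝓘(ℝ, E)) hz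
    rw [modelWithCornersSelf_coe, Set.range_id, mfderivWithin_univ] at h
    exact h
  have hd : ∀ X : (g : G) → TangentSpace 𝓘(ℝ, E) g, MDifferentiableAt 𝓘(ℝ, E) 𝓘(ℝ, E).tangent
      (fun g => (⟨g, X g⟩ : TangentBundle 𝓘(ℝ, E) G)) x → DifferentiableAt ℝ
        (fun z : E => (show E from
          (mfderiv 𝓘(ℝ, E) 𝓘(ℝ, E) φ.symm z).inverse (X (φ.symm z)))) y := by
    intro X hX
    have h := (hX.mdifferentiableWithinAt
      (s := Set.univ)).differentiableWithinAt_mpullbackWithin_vectorField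
    rw [modelWithCornersSelf_coe, Set.range_id, Set.preimage_univ, Set.inter_univ,
      mpullbackWithin_univ] at h
    have h' : DifferentiableWithinAt ℝ (fun z : E => (show E from
          (mfderiv 𝓘(ℝ, E) 𝓘(ℝ, E) φ.symm z).inverse (X (φ.symm z)))) Set.univ y := h
    exact differentiableWithinAt_univ.1 h'
  have hV' : DifferentiableAt ℝ V' y := hd V hV
  have hW' : DifferentiableAt ℝ W' y := hd W hW
  have hs : ∀ z ∈ φ.target, MDifferentiableAt 𝓘(ℝ, E) 𝓘(ℝ, E) φ.symm z := by
    intro z hz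
    have h := mdifferentiableWithinAt_extChartAt_symm (I := 𝓘(ℝ, E)) hz
    rw [modelWithCornersSelf_coe, Set.range_id, mdifferentiableWithinAt_univ] at h
    exact h
  -- chain rule in the chart
  have chain : ∀ (k : G → F) (X : (g : G) → TangentSpace 𝓘(ℝ, E) g), ∀ z ∈ φ.target,
      MDifferentiableAt 𝓘(ℝ, E) 𝓘(ℝ, F) k (φ.symm z) →
      fderiv ℝ (k ∘ φ.symm) z ((mfderiv 𝓘(ℝ, E) 𝓘(ℝ, E) φ.symm z).inverse (X (φ.symm z)))
        = derivAlong k X (φ.symm z) := by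
    intro k X z hz hk
    have h1 := mfderiv_comp z hk (hs z hz)
    rw [← mfderiv_eq_fderiv, h1]
    have h2 := (hinv z hz).self_comp_inverse
    have h3 := congrArg (fun L => L (X (φ.symm z))) h2
    exact congrArg (mfderiv 𝓘(ℝ, E) 𝓘(ℝ, F) k (φ.symm z)) h3
  have hfx : ∀ g, MDifferentiableAt 𝓘(ℝ, E) 𝓘(ℝ, F) f g := fun g => hf.mdifferentiableAt (by simp)
  have hfc : ContDiffAt ℝ ∞ (f ∘ φ.symm) y := by
    have h1 : ContMDiffAt 𝓘(ℝ, E) 𝓘(ℝ, E) ∞ φ.symm y :=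
      (contMDiffOn_extChartAt_symm (n := ∞) x).contMDiffAt hnt
    exact ((hf.contMDiffAt (x := φ.symm y)).comp y h1).contDiffAt
  have key := fderiv_apply_lieBracket (𝕜 := ℝ) (n := ∞) hfc
    (by simpa using ENat.LEInfty.out) hW' hV'
  have eW : (fun z => fderiv ℝ (f ∘ φ.symm) z (W' z)) =ᶠ[nhds y] (derivAlong f W) ∘ φ.symm := by
    filter_upwards [hnt] with z hz
    exact chain f W z hz (hfx _)
  have eV : (fun z => fderiv ℝ (f ∘ φ.symm) z (V' z)) =ᶠ[nhds y] (derivAlong f V) ∘ φ.symm := by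
    filter_upwards [hnt] with z hz
    exact chain f V z hz (hfx _)
  rw [eW.fderiv_eq, eV.fderiv_eq] at key
  have c1 := chain (derivAlong f W) V y hyt (by rw [hyx]; exact hfW)
  have c2 := chain (derivAlong f V) W y hyt (by rw [hyx]; exact hfV)
  have c0 : fderiv ℝ (f ∘ φ.symm) y (lieBracket ℝ V' W' y) =
      derivAlong f (mlieBracket 𝓘(ℝ, E) V W) x := by
    have h1 := mfderiv_comp y (hfx (φ.symm y)) (hs y hyt)
    have i1 : mfderiv 𝓘(ℝ, E) 𝓘(ℝ, E) φ x = ContinuousLinearMap.id ℝ _ := mfderiv_extChartAt_self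
    have i2 : mfderiv 𝓘(ℝ, E) 𝓘(ℝ, E) φ.symm y = ContinuousLinearMap.id ℝ _ := by
      have h := mfderivWithin_range_extChartAt_symm (I := 𝓘(ℝ, E)) (x := x)
      rw [modelWithCornersSelf_coe, Set.range_id, mfderivWithin_univ] at h
      exact h
    rw [i1] at hbr
    have i3 : (ContinuousLinearMap.id ℝ E).inverse B = B := by
      rw [ContinuousLinearMap.inverse_id]; rfl
    have hbr' : mlieBracket 𝓘(ℝ, E) V W x = B := hbr.trans i3
    rw [← mfderiv_eq_fderiv, h1, i2, derivAlong, hbr']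
    change mfderiv 𝓘(ℝ, E) 𝓘(ℝ, F) f (φ.symm y) B = mfderiv 𝓘(ℝ, E) 𝓘(ℝ, F) f x B
    rw [hyx]
  rw [← c0, key]
  change fderiv ℝ (derivAlong f W ∘ φ.symm) y _ - fderiv ℝ (derivAlong f V ∘ φ.symm) y _ = _
  rw [c1, c2, hyx]
end LieGroup

section Representation
open scoped TensorProduct
variable {E : Type*} [NormedAddCommGroup E] [NormedSpace ℝ E]
  {G : Type*} [TopologicalSpace G] [ChartedSpace E G] [Group G] [LieGroup 𝓘(ℝ, E) ∞ G]
  {H : Type*} [NormedAddCommGroup H] [InnerProductSpace ℂ H] [CompleteSpace H]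

/-- The orbit map `g ↦ U(g) φ` of a vector `φ`. -/
def orbitMap (U : G →* unitary (H →L[ℂ] H)) (φ : H) (g : G) : H := (U g : H →L[ℂ] H) φ

variable (E) in
/-- The space `𝒟^∞(U)` of `C^∞`-vectors: those `φ` for which `g ↦ U(g) φ` is a `C^∞` map. -/
def smoothVectors (U : G →* unitary (H →L[ℂ] H)) : Submodule ℂ H where
  carrier := {φ | ContMDiff 𝓘(ℝ, E) 𝓘(ℝ, H) ∞ (orbitMap U φ)}
  add_mem' := by
    intro φ ψ hφ hψ
    have h : orbitMap U (φ + ψ) = orbitMap U φ + orbitMap U ψ := by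
      ext g; simp [orbitMap]
    simpa only [Set.mem_ofPred_eq, h] using ContMDiff.add hφ hψ
  zero_mem' := by
    have h : orbitMap U (0 : H) = fun _ => 0 := by ext g; simp [orbitMap]
    simpa only [Set.mem_ofPred_eq, h] using contMDiff_const
  smul_mem' := by
    intro c φ hφ
    have h : orbitMap U (c • φ) = fun g => ((c • ContinuousLinearMap.id ℝ H) : H →L[ℝ] H) (orbitMap U φ g) := by
      ext g; simp [orbitMap]
    rw [Set.mem_ofPred_eq, h]
    exact (c • ContinuousLinearMap.id ℝ H : H →L[ℝ] H).contMDiff.comp hφ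

/-- The vector `d/dt U(exp tx) φ |_{t=0}`, as the derivative at the identity, in the direction
`x` of the Lie algebra `T₁G`, of the map `g ↦ U(g) φ`; see `hasDerivAt_orbitMap`. -/
def derivVec (U : G →* unitary (H →L[ℂ] H)) (x : GroupLieAlgebra 𝓘(ℝ, E) G) (φ : H) : H :=
  mfderiv 𝓘(ℝ, E) 𝓘(ℝ, H) (orbitMap U φ) 1 x

/-- The left-invariant field of `x` acts on orbit maps through `dU(x)`. -/
theorem derivAlong_orbitMap (U : G →* unitary (H →L[ℂ] H)) (x : GroupLieAlgebra 𝓘(ℝ, E) G)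
    {φ : H} (hφ : φ ∈ smoothVectors E U) :
    derivAlong (orbitMap U φ) (mulInvariantVectorField x) = orbitMap U (derivVec U x φ) := by
  have hd : ∀ g, MDifferentiableAt 𝓘(ℝ, E) 𝓘(ℝ, H) (orbitMap U φ) g :=
    fun g => ContMDiff.mdifferentiableAt hφ (by simp)
  ext g
  have hm : MDifferentiableAt 𝓘(ℝ, E) 𝓘(ℝ, E) (fun b : G => g * b) 1 :=
    (contMDiff_mul_left (n := ∞)).mdifferentiableAt (by simp)
  have h1 : mfderiv 𝓘(ℝ, E) 𝓘(ℝ, H) (orbitMap U φ ∘ fun b => g * b) 1 =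
    (mfderiv 𝓘(ℝ, E) 𝓘(ℝ, H) (orbitMap U φ) (g * 1)).comp
      (mfderiv 𝓘(ℝ, E) 𝓘(ℝ, E) (fun b => g * b) 1) := mfderiv_comp 1 (hd _) hm
  let L : H →L[ℝ] H := (U g : H →L[ℂ] H).restrictScalars ℝ
  have hL : (orbitMap U φ ∘ fun b => g * b) = L ∘ orbitMap U φ := by
    ext b; simp [orbitMap, L]
  have h2 : mfderiv 𝓘(ℝ, E) 𝓘(ℝ, H) (L ∘ orbitMap U φ) 1 =
    (mfderiv 𝓘(ℝ, H) 𝓘(ℝ, H) L (orbitMap U φ 1)).comp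
      (mfderiv 𝓘(ℝ, E) 𝓘(ℝ, H) (orbitMap U φ) 1) :=
    mfderiv_comp 1 L.differentiableAt.mdifferentiableAt (hd _)
  rw [hL, h2, ContinuousLinearMap.mfderiv_eq] at h1
  have h3 := congrArg (fun T => T x) h1
  have h4 : L (derivVec U x φ) = mfderiv 𝓘(ℝ, E) 𝓘(ℝ, H) (orbitMap U φ) (g * 1)
    (mulInvariantVectorField x g) := h3
  have h5 : mfderiv 𝓘(ℝ, E) 𝓘(ℝ, H) (orbitMap U φ) (g * 1)
    (mulInvariantVectorField x g) = derivAlong (orbitMap U φ) (mulInvariantVectorField x) g := by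
    rw [derivAlong]
    congr 2
    exact mul_one g
  exact (h4.trans h5).symm

/-- `dU(x)` leaves `𝒟^∞(U)` invariant. -/
theorem derivVec_mem (U : G →* unitary (H →L[ℂ] H)) (x : GroupLieAlgebra 𝓘(ℝ, E) G)
    {φ : H} (hφ : φ ∈ smoothVectors E U) : derivVec U x φ ∈ smoothVectors E U := by
  change ContMDiff _ _ _ _
  rw [← derivAlong_orbitMap U x hφ]
  exact contMDiff_derivAlong_mulInvariantVectorField hφ x

theorem derivVec_add (U : G →* unitary (H →L[ℂ] H)) (x : GroupLieAlgebra 𝓘(ℝ, E) G)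
    {φ ψ : H} (hφ : φ ∈ smoothVectors E U) (hψ : ψ ∈ smoothVectors E U) :
    derivVec U x (φ + ψ) = derivVec U x φ + derivVec U x ψ := by
  have h : orbitMap U (φ + ψ) = orbitMap U φ + orbitMap U ψ := by
    ext g; simp [orbitMap]
  have h1 := mfderiv_add (I := 𝓘(ℝ, E)) (z := (1 : G))
    (ContMDiff.mdifferentiableAt hφ (by simp)) (ContMDiff.mdifferentiableAt hψ (by simp))
  rw [derivVec, h]
  exact congrArg (fun T => T x) h1

theorem derivVec_smul (U : G →* unitary (H →L[ℂ] H)) (x : GroupLieAlgebra 𝓘(ℝ, E) G)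
    (c : ℂ) {φ : H} (hφ : φ ∈ smoothVectors E U) :
    derivVec U x (c • φ) = c • derivVec U x φ := by
  let L : H →L[ℝ] H := c • ContinuousLinearMap.id ℝ H
  have h : orbitMap U (c • φ) = L ∘ orbitMap U φ := by
    ext g; simp [orbitMap, L]
  have h1 : mfderiv 𝓘(ℝ, E) 𝓘(ℝ, H) (L ∘ orbitMap U φ) 1 =
    (mfderiv 𝓘(ℝ, H) 𝓘(ℝ, H) L (orbitMap U φ 1)).comp
      (mfderiv 𝓘(ℝ, E) 𝓘(ℝ, H) (orbitMap U φ) 1) :=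
    mfderiv_comp 1 L.differentiableAt.mdifferentiableAt (ContMDiff.mdifferentiableAt hφ (by simp))
  rw [ContinuousLinearMap.mfderiv_eq] at h1
  rw [derivVec, h]
  exact congrArg (fun T => T x) h1

/-- For any curve `γ` in `G` through the identity with velocity `x` at `t = 0` (in particular for
the one-parameter group `t ↦ exp (t x)`), `d/dt U(γ t) φ |_{t=0}` is the vector `derivVec U x φ`. -/
theorem hasDerivAt_orbitMap (U : G →* unitary (H →L[ℂ] H)) (x : GroupLieAlgebra 𝓘(ℝ, E) G)
    {φ : H} (hφ : φ ∈ smoothVectors E U) (γ : ℝ → G) (h0 : γ 0 = 1)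
    (hγ : MDifferentiableAt 𝓘(ℝ, ℝ) 𝓘(ℝ, E) γ 0)
    (hx : (mfderiv 𝓘(ℝ, ℝ) 𝓘(ℝ, E) γ 0 (1 : ℝ) : E) = x) :
    HasDerivAt (fun t => (U (γ t) : H →L[ℂ] H) φ) (derivVec U x φ) 0 := by
  have hm : MDifferentiableAt 𝓘(ℝ, E) 𝓘(ℝ, H) (orbitMap U φ) (γ 0) :=
    ContMDiff.mdifferentiableAt hφ (by simp)
  have h1 : mfderiv 𝓘(ℝ, ℝ) 𝓘(ℝ, H) (orbitMap U φ ∘ γ) 0 =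
      (mfderiv 𝓘(ℝ, E) 𝓘(ℝ, H) (orbitMap U φ) (γ 0)).comp (mfderiv 𝓘(ℝ, ℝ) 𝓘(ℝ, E) γ 0) :=
    mfderiv_comp 0 hm hγ
  have h2 : DifferentiableAt ℝ (orbitMap U φ ∘ γ) 0 :=
    mdifferentiableAt_iff_differentiableAt.1 (hm.comp 0 hγ)
  have h3 : deriv (orbitMap U φ ∘ γ) 0 =
      mfderiv 𝓘(ℝ, E) 𝓘(ℝ, H) (orbitMap U φ) (γ 0) x := by
    rw [← fderiv_apply_one_eq_deriv, ← mfderiv_eq_fderiv, h1, ← hx]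
    rfl
  have h4 : deriv (orbitMap U φ ∘ γ) 0 = derivVec U x φ := by
    rw [h3, h0]; rfl
  rw [← h4]
  exact h2.hasDerivAt

/-- The operator `dU(x)`, `x` in the Lie algebra, from `𝒟^∞(U)` to itself. -/
def dUop (U : G →* unitary (H →L[ℂ] H)) (x : GroupLieAlgebra 𝓘(ℝ, E) G) :
    Module.End ℂ (smoothVectors E U) where
  toFun φ := ⟨derivVec U x φ, derivVec_mem U x φ.2⟩
  map_add' φ ψ := Subtype.ext (derivVec_add U x φ.2 ψ.2)
  map_smul' c φ := Subtype.ext (derivVec_smul U x c φ.2)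

/-- `x ↦ dU(x)` is a representation of the (real) Lie algebra of `G` on `𝒟^∞(U)`. -/
def dULie [CompleteSpace E] (U : G →* unitary (H →L[ℂ] H)) :
    GroupLieAlgebra 𝓘(ℝ, E) G →ₗ⁅ℝ⁆ Module.End ℂ (smoothVectors E U) where
  toFun := dUop U
  map_add' x y := by
    ext φ
    exact map_add (mfderiv 𝓘(ℝ, E) 𝓘(ℝ, H) (orbitMap U (φ : H)) 1) x y
  map_smul' c x := by
    ext φ
    exact map_smul (mfderiv 𝓘(ℝ, E) 𝓘(ℝ, H) (orbitMap U (φ : H)) 1) c x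
  map_lie' := by
    intro x y
    ext φ
    have hφ := φ.2
    have h := derivAlong_mlieBracket (f := orbitMap U (φ : H)) hφ (1 : G)
      (mdifferentiableAt_mulInvariantVectorField x) (mdifferentiableAt_mulInvariantVectorField y)
      ((contMDiff_derivAlong_mulInvariantVectorField hφ x).mdifferentiableAt (by simp))
      ((contMDiff_derivAlong_mulInvariantVectorField hφ y).mdifferentiableAt (by simp))
    rw [derivAlong_orbitMap U x hφ, derivAlong_orbitMap U y hφ,
      derivAlong_orbitMap U x (derivVec_mem U y hφ),
      derivAlong_orbitMap U y (derivVec_mem U x hφ)] at h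
    simp only [orbitMap, map_one] at h
    exact h

/-- The complex linear extension of `dU` to the complexified Lie algebra. -/
def dUComplexLinear [CompleteSpace E] (U : G →* unitary (H →L[ℂ] H)) :
    ℂ ⊗[ℝ] GroupLieAlgebra 𝓘(ℝ, E) G →ₗ[ℂ] Module.End ℂ (smoothVectors E U) :=
  TensorProduct.AlgebraTensorModule.lift
    ((LinearMap.lsmul ℂ _).flip.restrictScalars₁₂ ℝ ℂ ∘ₗ (dULie U).toLinearMap).flip

theorem dUComplexLinear_tmul [CompleteSpace E] (U : G →* unitary (H →L[ℂ] H)) (c : ℂ)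
    (x : GroupLieAlgebra 𝓘(ℝ, E) G) : dUComplexLinear U (c ⊗ₜ[ℝ] x) = c • dUop U x := rfl

/-- A linear map on a complexified Lie algebra preserves brackets if it does so on pure tensors. -/
theorem map_lie_of_tmul {𝔤 R : Type*} [LieRing 𝔤] [LieAlgebra ℝ 𝔤] [Ring R] [Algebra ℂ R]
    (f : ℂ ⊗[ℝ] 𝔤 →ₗ[ℂ] R)
    (hf : ∀ (s t : ℂ) (x y : 𝔤), f ((s * t) ⊗ₜ[ℝ] ⁅x, y⁆) = ⁅f (s ⊗ₜ[ℝ] x), f (t ⊗ₜ[ℝ] y)⁆)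
    (a b : ℂ ⊗[ℝ] 𝔤) : f ⁅a, b⁆ = ⁅f a, f b⁆ := by
  induction a using TensorProduct.induction_on with
  | zero => rw [zero_lie, map_zero, zero_lie]
  | add a₁ a₂ h₁ h₂ => rw [add_lie, map_add, map_add, add_lie, h₁, h₂]
  | tmul s x =>
    induction b using TensorProduct.induction_on with
    | zero => rw [← lie_skew, zero_lie, neg_zero, map_zero, lie_zero]
    | add b₁ b₂ h₁ h₂ =>
      rw [← lie_skew, add_lie, neg_add, lie_skew, lie_skew, map_add, map_add, lie_add, h₁, h₂]
    | tmul t y => exact hf s t x y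

/-- The complex linear extension of `dU` is a homomorphism of complex Lie algebras. -/
def dUComplex [CompleteSpace E] (U : G →* unitary (H →L[ℂ] H)) :
    ℂ ⊗[ℝ] GroupLieAlgebra 𝓘(ℝ, E) G →ₗ⁅ℂ⁆ Module.End ℂ (smoothVectors E U) where
  toLinearMap := dUComplexLinear U
  map_lie' := by
    intro a b
    refine map_lie_of_tmul (dUComplexLinear U) (fun s t x y => ?_) a b
    have h : dUop U ⁅x, y⁆ = ⁅dUop U x, dUop U y⁆ := (dULie U).map_lie x y
    rw [dUComplexLinear_tmul, dUComplexLinear_tmul, dUComplexLinear_tmul, h, Ring.lie_def,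
      Ring.lie_def, smul_mul_smul_comm, smul_mul_smul_comm, smul_sub, mul_comm t s]

/-- The infinitesimal representation `dU` of the enveloping algebra `ℰ(𝒢)`, the universal
enveloping algebra of the complexified Lie algebra of `G`, on `𝒟^∞(U)`. -/
def dUEnveloping [CompleteSpace E] (U : G →* unitary (H →L[ℂ] H)) :
    UniversalEnvelopingAlgebra ℂ (ℂ ⊗[ℝ] GroupLieAlgebra 𝓘(ℝ, E) G) →ₐ[ℂ]
      Module.End ℂ (smoothVectors E U) :=
  UniversalEnvelopingAlgebra.lift ℂ (dUComplex U)

variable (E) in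
/-- The operator algebra `dU(ℰ(𝒢))` on the domain `𝒟^∞(U)`. -/
def dUAlgebra [CompleteSpace E] (U : G →* unitary (H →L[ℂ] H)) :
    Subalgebra ℂ (Module.End ℂ (smoothVectors E U)) :=
  (dUEnveloping (E := E) U).range

end Representation

section TraceClass

variable {H : Type*} [NormedAddCommGroup H] [InnerProductSpace ℂ H] [CompleteSpace H]

variable (H) in
/-- The index set of a chosen orthonormal basis of `H`. -/
def basisIndex : Set H := (exists_hilbertBasis ℂ H).choose

variable (H) in
/-- A chosen orthonormal (Hilbert) basis of `H`. -/
def stdBasis : HilbertBasis (basisIndex H) ℂ H := (exists_hilbertBasis ℂ H).choose_spec.choose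

/-- The trace `∑ ⟨e_n, L e_n⟩` of an everywhere defined operator. It is only used for trace class
operators, for which the series converges and does not depend on the basis. -/
def trace (L : H →ₗ[ℂ] H) : ℂ := ∑' i, inner ℂ (stdBasis H i) (L (stdBasis H i))

/-- An everywhere defined operator is trace class iff it is bounded and `Tr |T| < ∞`, with
`|T| = √(T* T)`. -/
def IsTraceClass (L : H →ₗ[ℂ] H) : Prop :=
  ∃ T : H →L[ℂ] H, (T : H →ₗ[ℂ] H) = L ∧
    Summable fun i => inner ℂ (stdBasis H i) (CFC.abs T (stdBasis H i))

variable {D : Submodule ℂ H}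

/-- The product `A T`, defined on all of `H`, of an operator `A : D → D` and a bounded operator `T`
on `H` with range in `D`. -/
def compOn (A : Module.End ℂ D) (T : H →L[ℂ] H) (hT : ∀ x, T x ∈ D) : H →ₗ[ℂ] H :=
  D.subtype ∘ₗ A ∘ₗ (T : H →ₗ[ℂ] H).codRestrict D hT

/-- Membership in `𝒯₁(M)`: trace class operators `T` with `T H ⊆ D` and `T* H ⊆ D` such that `A T`
and `A T*` are trace class for every `A` in `M`. -/
structure MemTraceIdeal (M : Subalgebra ℂ (Module.End ℂ D)) (T : H →L[ℂ] H) : Prop where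
  traceClass : IsTraceClass (T : H →ₗ[ℂ] H)
  range_mem : ∀ x, T x ∈ D
  adjoint_range_mem : ∀ x, ContinuousLinearMap.adjoint T x ∈ D
  comp_traceClass : ∀ A ∈ M, IsTraceClass (compOn A T range_mem)
  comp_adjoint_traceClass : ∀ A ∈ M,
    IsTraceClass (compOn A (ContinuousLinearMap.adjoint T) adjoint_range_mem)

/-- The state space of an algebra `M` of operators on `D`: the positive (in particular self-adjoint)
operators in `𝒯₁(M)` of trace one. -/
structure State (M : Subalgebra ℂ (Module.End ℂ D)) where
  op : H →L[ℂ] H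
  mem : MemTraceIdeal M op
  isPositive : op.IsPositive
  trace_eq_one : trace (op : H →ₗ[ℂ] H) = 1

variable {M : Subalgebra ℂ (Module.End ℂ D)}

/-- The expectation `Tr (A ρ)` of `A` in the state `ρ`. -/
def expectation (A : M) (ρ : State M) : ℂ :=
  trace (compOn (A : Module.End ℂ D) ρ.op ρ.mem.range_mem)

/-- The weak topology on the state space, the coarsest one for which all functions
`ρ ↦ Tr (A ρ)`, `A ∈ M`, are continuous. -/
instance State.instTopologicalSpace : TopologicalSpace (State M) :=
  TopologicalSpace.induced (fun ρ (A : M) => expectation A ρ) Pi.topologicalSpace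

theorem continuous_expectation (A : M) : Continuous (expectation A) :=
  (continuous_apply A).comp (continuous_induced_dom (f := fun ρ (A : M) => expectation A ρ))

/-- The function `a_Q(ρ) = Tr (A ρ)`. For the symmetric operators to which it is applied `Tr (A ρ)`
is real. -/
def aQ (A : M) (ρ : State M) : ℝ := (expectation A ρ).re

theorem continuous_aQ (A : M) : Continuous (aQ A) :=
  Complex.continuous_re.comp (continuous_expectation A)

/-- The number `a_Q(W)` defined by `A` to the extent `W`, `W` open in the state space: the section
over `W` of the sheaf of continuous real functions given by the restriction of `a_Q` to `W`. -/
def qrNumber (A : M) (W : TopologicalSpace.Opens (State M)) : C(W, ℝ) :=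
  ⟨fun ρ => aQ A ρ, (continuous_aQ A).comp continuous_subtype_val⟩

/-- An operator `A : D → D` as a partially defined operator on `H` with domain `D`. -/
def toPartial (A : Module.End ℂ D) : H →ₗ.[ℂ] H := ⟨D, D.subtype ∘ₗ A⟩

/-- `A : D → D` is essentially self-adjoint: `D` is dense, `A` is symmetric, and the closure of `A`
is self-adjoint. -/
def IsEssentiallySelfAdjoint (A : Module.End ℂ D) : Prop :=
  Dense (D : Set H) ∧ (∀ φ ψ : D, inner ℂ (A φ : H) (ψ : H) = inner ℂ (φ : H) (A ψ : H)) ∧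
    IsSelfAdjoint (toPartial A).closure

end TraceClass

end QRNumbers

end

open QRNumbers

/-! The argument applies to any algebra `M` of operators on a domain `D`. Two facts carry it:
expectations are affine on the convex set of states, and a symmetric operator on a complex space is
determined by its quadratic form.

Fix ρ in W and let σ be any state. The segment (1 - t)ρ + tσ depends continuously on t in the weak
topology, so it stays in W for some t > 0. If `aQ A` and `aQ B` agree on W, they agree at ρ and at
this mixture; affinity and t > 0 force agreement at σ (`aQ_eq_of_qrNumber_eq`). Taking for σ the
vector states of unit vectors φ in D gives ⟨φ, Aφ⟩ = ⟨φ, Bφ⟩, and complex polarization yields A = B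
(`eq_of_aQ_eq`).

The analytic work lies in convexity. With trace class defined by Tr |T| < ∞, closure under sums is
not evident, since |S + T| is not controlled by |S| + |T|. `isTraceClass_iff` replaces the
definition by convergence of the trace series of V T for every bounded V, a condition visibly linear
in T. -/

namespace QRNumbers

section TraceClass

variable {H : Type*} [NormedAddCommGroup H] [InnerProductSpace ℂ H] [CompleteSpace H]

/-! ### Factorization and Hilbert–Schmidt estimates -/

/-- Douglas' lemma: an operator dominated by `B` factors through `B`. -/
theorem exists_factor_of_norm_le {A B : H →L[ℂ] H} (h : ∀ x, ‖A x‖ ≤ ‖B x‖) :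
    ∃ V : H →L[ℂ] H, A = V * B := by
  -- V sends Bx to Ax on the range of B, extends by continuity to the closure K, and vanishes on the
  -- orthogonal complement of K.
  let K : Submodule ℂ H := (LinearMap.range (B : H →ₗ[ℂ] H)).topologicalClosure
  have hBK : ∀ x, (B : H →ₗ[ℂ] H) x ∈ K := fun x =>
    Submodule.le_topologicalClosure _ (LinearMap.mem_range_self _ x)
  let e : H →ₗ[ℂ] K := (B : H →ₗ[ℂ] H).codRestrict K hBK
  have hd : DenseRange e := by
    intro y
    rw [Topology.IsInducing.subtypeVal.closure_eq_preimage_closure_image, Set.mem_preimage]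
    have hr : (Subtype.val '' Set.range e : Set H) =
        (LinearMap.range (B : H →ₗ[ℂ] H) : Set H) := by
      rw [← Set.range_comp]; rfl
    have hy : (y : H) ∈ closure (LinearMap.range (B : H →ₗ[ℂ] H) : Set H) := y.2
    rw [← hr] at hy
    exact hy
  have : CompleteSpace K := (Submodule.isClosed_topologicalClosure _).completeSpace_coe
  have hn : ∃ C, ∀ x, ‖(A : H →ₗ[ℂ] H) x‖ ≤ C * ‖e x‖ := ⟨1, fun x => by simpa [e] using h x⟩
  refine ⟨((A : H →ₗ[ℂ] H).extendOfNorm e) ∘L K.orthogonalProjectionOnto, ?_⟩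
  ext x
  have h1 : K.orthogonalProjectionOnto (B x) = e x :=
    K.orthogonalProjectionOnto_mem_subspace_eq_self (e x)
  have h2 := LinearMap.extendOfNorm_eq hd hn x
  simpa [h1] using h2.symm

/-- Since |T|² = T*T, both squared norms equal ⟨T*Tx, x⟩. With Douglas' lemma this factors T through
|T| and |T| through T, in place of the polar decomposition. -/
theorem norm_abs_apply (T : H →L[ℂ] H) (x : H) : ‖CFC.abs T x‖ = ‖T x‖ := by
  have hs : ContinuousLinearMap.adjoint (CFC.abs T) = CFC.abs T :=
    (CFC.abs_nonneg T).isSelfAdjoint.star_eq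
  have h1 : CFC.abs T * CFC.abs T = ContinuousLinearMap.adjoint T * T := CFC.abs_mul_abs T
  have h2 := ContinuousLinearMap.apply_norm_sq_eq_inner_adjoint_left (CFC.abs T) x
  rw [hs, ← ContinuousLinearMap.mul_def, h1, ContinuousLinearMap.mul_def,
    ← ContinuousLinearMap.apply_norm_sq_eq_inner_adjoint_left T x] at h2
  exact (pow_left_inj₀ (norm_nonneg _) (norm_nonneg _) two_ne_zero).1 h2

theorem hasSum_norm_inner_sq {ι : Type*} (b : HilbertBasis ι ℂ H) (x : H) :
    HasSum (fun i => ‖inner ℂ (b i) x‖ ^ 2) (‖x‖ ^ 2) := by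
  have h := b.hasSum_inner_mul_inner x x
  rw [inner_self_eq_norm_sq_to_K] at h
  have h1 : ∀ i, inner ℂ x (b i) * inner ℂ (b i) x = ((‖inner ℂ (b i) x‖ ^ 2 : ℝ) : ℂ) := by
    intro i
    rw [← inner_conj_symm x (b i), RCLike.conj_mul]
    simp
  simp only [h1] at h
  exact Complex.hasSum_ofReal.1 (by simpa using h)

/-- The adjoint of a Hilbert–Schmidt operator is Hilbert–Schmidt. -/
theorem summable_norm_sq_adjoint {ι : Type*} (b : HilbertBasis ι ℂ H) {A : H →L[ℂ] H}
    (h : Summable fun i => ‖A (b i)‖ ^ 2) :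
    Summable fun i => ‖ContinuousLinearMap.adjoint A (b i)‖ ^ 2 := by
  -- The squared matrix entries of A form a nonnegative double family. By Parseval its sums in one
  -- index are the ‖A bᵢ‖², and in the other the ‖A* bᵢ‖².
  have hp : Summable fun p : ι × ι => ‖inner ℂ (b p.2) (A (b p.1))‖ ^ 2 := by
    rw [summable_prod_of_nonneg fun _ => sq_nonneg _]
    refine ⟨fun i => (hasSum_norm_inner_sq b (A (b i))).summable, ?_⟩
    simpa only [(hasSum_norm_inner_sq b (A (b _))).tsum_eq] using h
  have hq := ((summable_prod_of_nonneg fun _ => sq_nonneg _).1 hp.prod_symm).2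
  refine hq.congr fun i => ?_
  rw [← (hasSum_norm_inner_sq b (ContinuousLinearMap.adjoint A (b i))).tsum_eq]
  refine tsum_congr fun j => ?_
  rw [ContinuousLinearMap.adjoint_inner_right, ← norm_inner_symm]
  rfl

theorem summable_norm_sq_mul_left {ι : Type*} (b : ι → H) {A : H →L[ℂ] H} (C : H →L[ℂ] H)
    (h : Summable fun i => ‖A (b i)‖ ^ 2) : Summable fun i => ‖(C * A) (b i)‖ ^ 2 := by
  refine Summable.of_nonneg_of_le (fun _ => sq_nonneg _) (fun i => ?_) (h.mul_left (‖C‖ ^ 2))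
  rw [← mul_pow]
  exact pow_le_pow_left₀ (norm_nonneg _) (C.le_opNorm _) 2

/-- Cauchy–Schwarz and ab ≤ a² + b². It supplies the summable diagonal of a product of two
Hilbert–Schmidt operators. -/
theorem summable_inner_of_summable_norm_sq {ι : Type*} {f g : ι → H}
    (hf : Summable fun i => ‖f i‖ ^ 2) (hg : Summable fun i => ‖g i‖ ^ 2) :
    Summable fun i => inner ℂ (f i) (g i) := by
  refine Summable.of_norm_bounded (hf.add hg) fun i => ?_
  have h := norm_inner_le_norm (𝕜 := ℂ) (f i) (g i)
  nlinarith [sq_nonneg (‖f i‖ - ‖g i‖), sq_nonneg ‖f i‖, sq_nonneg ‖g i‖]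

/-! ### Trace class operators and linearity of the trace -/

/-- An operator is trace class iff the trace series of all its bounded left multiples converge. -/
theorem isTraceClass_iff (L : H →ₗ[ℂ] H) :
    IsTraceClass L ↔ ∃ T : H →L[ℂ] H, (T : H →ₗ[ℂ] H) = L ∧ ∀ V : H →L[ℂ] H,
      Summable fun i => inner ℂ (stdBasis H i) ((V * T) (stdBasis H i)) := by
  refine exists_congr fun T => and_congr_right fun _ => ⟨fun hT V => ?_, fun hT => ?_⟩
  -- Write T = V'|T| and S = √|T|. Then ‖S bᵢ‖² = ⟨bᵢ, |T| bᵢ⟩, so S is Hilbert–Schmidt, and ⟨bᵢ, V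
  -- T bᵢ⟩ = ⟨(V V' S)* bᵢ, S bᵢ⟩.
  · obtain ⟨V', hV'⟩ := exists_factor_of_norm_le fun x => (norm_abs_apply T x).ge
    set S : H →L[ℂ] H := CFC.sqrt (CFC.abs T) with hS
    have hSS : S * S = CFC.abs T := CFC.sqrt_mul_sqrt_self _ (CFC.abs_nonneg T)
    have hSa : ContinuousLinearMap.adjoint S = S :=
      (CFC.sqrt_nonneg (CFC.abs T)).isSelfAdjoint.star_eq
    have h1 : Summable fun i => ‖S (stdBasis H i)‖ ^ 2 := by
      have h2 : Summable fun i => ((‖S (stdBasis H i)‖ ^ 2 : ℝ) : ℂ) := by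
        refine hT.congr fun i => ?_
        rw [← hSS, mul_apply_eq_comp, ← ContinuousLinearMap.adjoint_inner_left, hSa,
          inner_self_eq_norm_sq_to_K]
        simp
      exact_mod_cast h2
    have h3 := summable_norm_sq_adjoint (stdBasis H) (summable_norm_sq_mul_left _ (V * V') h1)
    refine (summable_inner_of_summable_norm_sq h3 h1).congr fun i => ?_
    rw [ContinuousLinearMap.adjoint_inner_left, hV', ← hSS]
    rfl
  -- Conversely |T| = V T for some bounded V, and the hypothesis is applied to this V.
  · obtain ⟨V, hV⟩ := exists_factor_of_norm_le fun x => (norm_abs_apply T x).le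
    rw [hV]
    exact hT V

theorem IsTraceClass.summable {L : H →ₗ[ℂ] H} (h : IsTraceClass L) :
    Summable fun i => inner ℂ (stdBasis H i) (L (stdBasis H i)) := by
  obtain ⟨T, rfl, hT⟩ := (isTraceClass_iff L).1 h
  exact hT 1

theorem IsTraceClass.add {L L' : H →ₗ[ℂ] H} (h : IsTraceClass L) (h' : IsTraceClass L') :
    IsTraceClass (L + L') := by
  obtain ⟨T, rfl, hT⟩ := (isTraceClass_iff L).1 h
  obtain ⟨T', rfl, hT'⟩ := (isTraceClass_iff L').1 h'
  refine (isTraceClass_iff _).2 ⟨T + T', rfl, fun V => ?_⟩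
  simpa [mul_add, inner_add_right] using (hT V).add (hT' V)

theorem IsTraceClass.smul {L : H →ₗ[ℂ] H} (c : ℂ) (h : IsTraceClass L) :
    IsTraceClass (c • L) := by
  obtain ⟨T, rfl, hT⟩ := (isTraceClass_iff L).1 h
  refine (isTraceClass_iff _).2 ⟨c • T, rfl, fun V => ?_⟩
  simpa [inner_smul_right] using (hT V).mul_left c

open InnerProductSpace in
theorem isTraceClass_rankOne (x y : H) : IsTraceClass (rankOne ℂ x y : H →ₗ[ℂ] H) := by
  refine (isTraceClass_iff _).2 ⟨rankOne ℂ x y, rfl, fun V => ?_⟩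
  simpa [inner_smul_right] using (stdBasis H).summable_inner_mul_inner y (V x)

open InnerProductSpace in
theorem trace_rankOne (x y : H) : trace (rankOne ℂ x y : H →ₗ[ℂ] H) = inner ℂ y x := by
  simpa [trace, inner_smul_right] using (stdBasis H).tsum_inner_mul_inner y x

theorem trace_add {L L' : H →ₗ[ℂ] H} (h : IsTraceClass L) (h' : IsTraceClass L') :
    trace (L + L') = trace L + trace L' := by
  simpa [trace, inner_add_right] using h.summable.tsum_add h'.summable

theorem trace_smul (c : ℂ) (L : H →ₗ[ℂ] H) : trace (c • L) = c * trace L := by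
  simp [trace, tsum_mul_left]

/-! ### The ideal 𝒯₁(M): linear structure and rank one elements -/

variable {D : Submodule ℂ H} {M : Subalgebra ℂ (Module.End ℂ D)}

/-- The range proof depends on the operator, so `rw` cannot replace S by T inside `compOn`; this is
needed for adjoints of sums, multiples and rank one operators. -/
theorem compOn_congr (A : Module.End ℂ D) {S T : H →L[ℂ] H} (h : S = T) (hS : ∀ x, S x ∈ D)
    (hT : ∀ x, T x ∈ D) : compOn A S hS = compOn A T hT := by
  subst h; rfl

theorem compOn_add (A : Module.End ℂ D) {S T : H →L[ℂ] H} (hS : ∀ x, S x ∈ D)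
    (hT : ∀ x, T x ∈ D) (hST : ∀ x, (S + T) x ∈ D) :
    compOn A (S + T) hST = compOn A S hS + compOn A T hT := by
  ext x
  exact congrArg Subtype.val (map_add A ⟨S x, hS x⟩ ⟨T x, hT x⟩)

theorem compOn_smul (A : Module.End ℂ D) (c : ℂ) {T : H →L[ℂ] H} (hT : ∀ x, T x ∈ D)
    (hcT : ∀ x, (c • T) x ∈ D) : compOn A (c • T) hcT = c • compOn A T hT := by
  ext x
  exact congrArg Subtype.val (map_smul A c ⟨T x, hT x⟩)

theorem MemTraceIdeal.add {S T : H →L[ℂ] H} (hS : MemTraceIdeal M S) (hT : MemTraceIdeal M T) :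
    MemTraceIdeal M (S + T) where
  traceClass := hS.traceClass.add hT.traceClass
  range_mem x := D.add_mem (hS.range_mem x) (hT.range_mem x)
  adjoint_range_mem x := by
    rw [map_add]
    exact D.add_mem (hS.adjoint_range_mem x) (hT.adjoint_range_mem x)
  comp_traceClass A hA := by
    rw [compOn_add A hS.range_mem hT.range_mem]
    exact (hS.comp_traceClass A hA).add (hT.comp_traceClass A hA)
  comp_adjoint_traceClass A hA := by
    rw [compOn_congr A (map_add ContinuousLinearMap.adjoint S T) _
      fun x => D.add_mem (hS.adjoint_range_mem x) (hT.adjoint_range_mem x),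
      compOn_add A hS.adjoint_range_mem hT.adjoint_range_mem]
    exact (hS.comp_adjoint_traceClass A hA).add (hT.comp_adjoint_traceClass A hA)

theorem MemTraceIdeal.smul {T : H →L[ℂ] H} (c : ℂ) (hT : MemTraceIdeal M T) :
    MemTraceIdeal M (c • T) where
  traceClass := hT.traceClass.smul c
  range_mem x := D.smul_mem c (hT.range_mem x)
  adjoint_range_mem x := by
    rw [map_smulₛₗ]
    exact D.smul_mem _ (hT.adjoint_range_mem x)
  comp_traceClass A hA := by
    rw [compOn_smul A c hT.range_mem]
    exact (hT.comp_traceClass A hA).smul c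
  comp_adjoint_traceClass A hA := by
    rw [compOn_congr A (map_smulₛₗ ContinuousLinearMap.adjoint c T) _
      fun x => D.smul_mem _ (hT.adjoint_range_mem x),
      compOn_smul A _ hT.adjoint_range_mem]
    exact (hT.comp_adjoint_traceClass A hA).smul _

open InnerProductSpace in
-- However unbounded A is, its product with a rank one operator whose range lies in D is again of
-- the form `rankOne`, hence trace class.
theorem compOn_rankOne (A : Module.End ℂ D) (φ : D) (y : H)
    (h : ∀ x, rankOne ℂ (φ : H) y x ∈ D) :
    compOn A (rankOne ℂ (φ : H) y) h = (rankOne ℂ (A φ : H) y : H →ₗ[ℂ] H) := by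
  ext x
  exact congrArg Subtype.val (map_smul A (inner ℂ y x) φ)

open InnerProductSpace in
theorem rankOne_self_mem (φ : D) (x : H) : rankOne ℂ (φ : H) (φ : H) x ∈ D := by
  rw [rankOne_apply]
  exact D.smul_mem _ φ.2

open InnerProductSpace in
theorem memTraceIdeal_rankOne_self (φ : D) : MemTraceIdeal M (rankOne ℂ (φ : H) (φ : H)) where
  traceClass := isTraceClass_rankOne _ _
  range_mem := rankOne_self_mem φ
  adjoint_range_mem x := by
    rw [adjoint_rankOne]
    exact rankOne_self_mem φ x
  comp_traceClass A _ := by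
    rw [compOn_rankOne]
    exact isTraceClass_rankOne _ _
  comp_adjoint_traceClass A _ := by
    rw [compOn_congr A (adjoint_rankOne (φ : H) (φ : H)) _
      (rankOne_self_mem φ), compOn_rankOne]
    exact isTraceClass_rankOne _ _

/-! ### Vector states and mixtures -/

/-- The vector state of a unit vector in the common domain. -/
noncomputable def vectorState (M : Subalgebra ℂ (Module.End ℂ D)) (φ : D) (hφ : ‖(φ : H)‖ = 1) : State M where
  op := InnerProductSpace.rankOne ℂ (φ : H) (φ : H)
  mem := memTraceIdeal_rankOne_self φ
  isPositive := InnerProductSpace.isPositive_rankOne_self _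
  trace_eq_one := by
    rw [trace_rankOne, inner_self_eq_norm_sq_to_K, hφ]
    simp

theorem expectation_vectorState (A : M) (φ : D) (hφ : ‖(φ : H)‖ = 1) :
    expectation A (vectorState M φ hφ) = inner ℂ (φ : H) ((A : Module.End ℂ D) φ : H) := by
  rw [← trace_rankOne, ← compOn_rankOne (A : Module.End ℂ D) φ (φ : H) (rankOne_self_mem φ)]
  rfl

/-- The convex combination `(1 - t) ρ + t σ` of two states. -/
noncomputable def mixedState (ρ σ : State M) (t : unitInterval) : State M where
  op := ((1 - (t : ℝ) : ℝ) : ℂ) • ρ.op + ((t : ℝ) : ℂ) • σ.op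
  mem := (ρ.mem.smul _).add (σ.mem.smul _)
  isPositive := (ρ.isPositive.smul_of_nonneg (by
      simpa using Complex.zero_le_real.2 (sub_nonneg.2 t.2.2))).add
    (σ.isPositive.smul_of_nonneg (Complex.zero_le_real.2 t.2.1))
  trace_eq_one := by
    rw [ContinuousLinearMap.toLinearMap_add, ContinuousLinearMap.toLinearMap_smul,
      ContinuousLinearMap.toLinearMap_smul, trace_add (ρ.mem.traceClass.smul _)
      (σ.mem.traceClass.smul _), trace_smul, trace_smul, ρ.trace_eq_one, σ.trace_eq_one]
    simp

theorem expectation_mixedState (A : M) (ρ σ : State M) (t : unitInterval) :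
    expectation A (mixedState ρ σ t) =
      ((1 - (t : ℝ) : ℝ) : ℂ) * expectation A ρ + ((t : ℝ) : ℂ) * expectation A σ := by
  have h1 := ρ.mem.comp_traceClass A A.2
  have h2 := σ.mem.comp_traceClass A A.2
  simp only [expectation, mixedState]
  rw [compOn_add (A : Module.End ℂ D) (ρ.mem.smul _).range_mem (σ.mem.smul _).range_mem,
    compOn_smul _ _ ρ.mem.range_mem, compOn_smul _ _ σ.mem.range_mem,
    trace_add (h1.smul _) (h2.smul _), trace_smul, trace_smul]

/-- The topology on states is induced by the expectations, and each of these is affine in t along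
the segment. -/
theorem continuous_mixedState (ρ σ : State M) : Continuous (mixedState ρ σ) := by
  refine continuous_induced_rng.2 (continuous_pi fun A => ?_)
  simp only [Function.comp_def, expectation_mixedState]
  fun_prop

/-- Every neighbourhood of a state contains a proper mixture of it with any other state. -/
theorem exists_mixedState_mem {W : Set (State M)} (hW : IsOpen W) {ρ : State M} (hρ : ρ ∈ W)
    (σ : State M) : ∃ t : unitInterval, 0 < t ∧ mixedState ρ σ t ∈ W := by
  have h0 : mixedState ρ σ 0 = ρ := by
    cases ρ; simp [mixedState]
  have h1 : mixedState ρ σ ⁻¹' W ∈ nhds (0 : unitInterval) :=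
    (hW.preimage (continuous_mixedState ρ σ)).mem_nhds (by rwa [Set.mem_preimage, h0])
  -- 0 is not isolated from the right in [0, 1], so the neighbourhood contains some t > 0.
  have : (nhdsWithin (0 : unitInterval) (Set.Ioi 0)).NeBot :=
    nhdsGT_neBot_of_exists_gt ⟨1, zero_lt_one⟩
  obtain ⟨t, ht, ht0⟩ := Filter.nonempty_of_mem
    (Filter.inter_mem (mem_nhdsWithin_of_mem_nhds h1) (self_mem_nhdsWithin (s := Set.Ioi 0)))
  exact ⟨t, ht0, ht⟩

theorem aQ_mixedState (A : M) (ρ σ : State M) (t : unitInterval) :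
    aQ A (mixedState ρ σ t) = (1 - t) * aQ A ρ + t * aQ A σ := by
  rw [aQ, expectation_mixedState, Complex.add_re, Complex.re_ofReal_mul, Complex.re_ofReal_mul]
  rfl

/-! ### From qr-numbers back to operators -/

/-- If two qr-numbers agree on a non-empty open set then they agree on all states. -/
theorem aQ_eq_of_qrNumber_eq {A B : M} {W : TopologicalSpace.Opens (State M)}
    (hW : (W : Set (State M)).Nonempty) (h : qrNumber A W = qrNumber B W) : aQ A = aQ B := by
  have hAB : ∀ τ ∈ W, aQ A τ = aQ B τ := by
    intro τ hτ
    have h1 : qrNumber A W ⟨τ, hτ⟩ = qrNumber B W ⟨τ, hτ⟩ := by rw [h]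
    exact h1
  obtain ⟨ρ, hρ⟩ := hW
  ext σ
  obtain ⟨t, ht, htW⟩ := exists_mixedState_mem W.isOpen hρ σ
  have h1 := hAB _ htW
  rw [aQ_mixedState, aQ_mixedState, hAB ρ hρ] at h1
  -- The common term (1 - t) `aQ B ρ` is cancelled first, then the factor t, nonzero because t > 0.
  exact mul_left_cancel₀ (Subtype.coe_lt_coe.2 ht).ne' (add_left_cancel h1)

/-- Symmetric operators in `M` with the same expectations in all vector states are equal. -/
theorem eq_of_aQ_eq {A B : M}
    (hA : ∀ φ ψ : D, inner ℂ ((A : Module.End ℂ D) φ : H) (ψ : H) =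
      inner ℂ (φ : H) ((A : Module.End ℂ D) ψ : H))
    (hB : ∀ φ ψ : D, inner ℂ ((B : Module.End ℂ D) φ : H) (ψ : H) =
      inner ℂ (φ : H) ((B : Module.End ℂ D) ψ : H))
    (h : aQ A = aQ B) : A = B := by
  have hsym : (A - B : Module.End ℂ D).IsSymmetric :=
    LinearMap.IsSymmetric.sub (fun φ ψ => hA φ ψ) (fun φ ψ => hB φ ψ)
  have hunit : ∀ φ : D, ‖(φ : H)‖ = 1 → inner ℂ ((A - B : Module.End ℂ D) φ) φ = 0 := by
    intro φ hφ
    have h1 := congrFun h (vectorState M φ hφ)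
    rw [aQ, aQ, expectation_vectorState, expectation_vectorState] at h1
    -- `aQ` records only real parts; by symmetry of A - B the quadratic form is real, so nothing is
    -- lost.
    rw [← hsym.coe_re_inner_apply_self, hsym φ φ]
    simpa [inner_sub_right, sub_eq_zero] using h1
  -- Polarization over ℂ: an operator whose quadratic form vanishes is zero.
  refine Subtype.ext (sub_eq_zero.1 ((inner_map_self_eq_zero _).1 fun φ => ?_))
  rcases eq_or_ne φ 0 with rfl | hφ
  · simp
  -- Normalizing φ multiplies the quadratic form by ‖φ‖⁻², which is nonzero.
  · have h2 := hunit (((‖φ‖⁻¹ : ℝ) : ℂ) • φ) (by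
      rw [Submodule.coe_smul, norm_smul]
      simp [hφ])
    rw [map_smul, inner_smul_left, inner_smul_right] at h2
    simpa [hφ] using h2

end TraceClass

end QRNumbers

theorem corollary15 {d : ℕ} {G : Type*} [TopologicalSpace G]
    [ChartedSpace (EuclideanSpace ℝ (Fin d)) G] [Group G] [LieGroup (𝓡 d) ∞ G]
    {H : Type*} [NormedAddCommGroup H] [InnerProductSpace ℂ H] [CompleteSpace H]
    [TopologicalSpace.SeparableSpace H]
    (U : G →* unitary (H →L[ℂ] H))
    (hU : ∀ φ : H, Continuous fun g : G => (U g : H →L[ℂ] H) φ)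
    (W : TopologicalSpace.Opens (State (dUAlgebra (EuclideanSpace ℝ (Fin d)) U)))
    (hW : (W : Set (State (dUAlgebra (EuclideanSpace ℝ (Fin d)) U))).Nonempty) :
    (∀ A B : dUAlgebra (EuclideanSpace ℝ (Fin d)) U,
      IsEssentiallySelfAdjoint (A : Module.End ℂ (smoothVectors (EuclideanSpace ℝ (Fin d)) U)) →
      IsEssentiallySelfAdjoint (B : Module.End ℂ (smoothVectors (EuclideanSpace ℝ (Fin d)) U)) →
      (qrNumber A W = qrNumber B W ↔ A = B)) ∧
    Set.InjOn (fun A : dUAlgebra (EuclideanSpace ℝ (Fin d)) U => qrNumber A W)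
      {A | IsEssentiallySelfAdjoint
        (A : Module.End ℂ (smoothVectors (EuclideanSpace ℝ (Fin d)) U))} := by
  have key : ∀ A B : dUAlgebra (EuclideanSpace ℝ (Fin d)) U,
      IsEssentiallySelfAdjoint (A : Module.End ℂ (smoothVectors (EuclideanSpace ℝ (Fin d)) U)) →
      IsEssentiallySelfAdjoint (B : Module.End ℂ (smoothVectors (EuclideanSpace ℝ (Fin d)) U)) →
      qrNumber A W = qrNumber B W → A = B := fun A B hA hB h =>
    eq_of_aQ_eq hA.2.1 hB.2.1 (aQ_eq_of_qrNumber_eq hW h)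
  exact ⟨fun A B hA hB => ⟨key A B hA hB, fun h => h ▸ rfl⟩, fun A hA B hB h => key A B hA hB h⟩
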